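/- All vector spaces, algebras and Hilbert spaces are over $\mathbb{R}$, and linear means real linear. A unital real $C^*$-algebra is a unital real Banach $*$-algebra $\mathcal{A}$ with $\|a^*a\|=\|a\|^2$ and $1+a^*a$ invertible for all $a\in\mathcal{A}$; $B(\mathcal{H})$ is the algebra of bounded linear operators on the Hilbert space $\mathcal{H}$. A linear map $\Phi:\mathcal{A}\to B(\mathcal{H})$ is completely positive (CP) if $\Phi(a^*)=\Phi(a)^*$ for all $a\in\mathcal{A}$ and $\sum_{i,j=1}^n T_i^*\Phi(a_i^*a_j)T_j\ge 0$ for all $n$, all $a_1,\dots,a_n\in\mathcal{A}$ and all $T_1,\dots,T_n\in B(\mathcal{H})$ (equivalently, all maps $\mathrm{id}_k\otimes\Phi: M_k(\mathcal{A})\to M_k(B(\mathcal{H}))$ are positive). A CP map $\Phi$ is pure if every CP map $\Psi$ for which $\Phi-\Psi$ is CP is of the form $t\Phi$ with $t\in[0,1]$. $\mathrm{UCP}(\mathcal{A},B(\mathcal{H}))$ is the set of CP maps with $\Phi(1)=I$. A map $\Phi\in\mathrm{UCP}(\mathcal{A},B(\mathcal{H}))$ is a $C^*$-extreme point if, whenever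 $\Phi(\cdot)=\sum_{j=1}^n T_j^*\Phi_j(\cdot)T_j$ with $\Phi_j\in\mathrm{UCP}(\mathcal{A},B(\mathcal{H}))$ and invertible $T_j\in B(\mathcal{H})$ such that $\sum_{j=1}^n T_j^*T_j=I$, there are unitaries $U_j\in B(\mathcal{H})$ with $\Phi_j(\cdot)=U_j^*\Phi(\cdot)U_j$ for all $j$. A real state is a linear functional $\phi:\mathcal{A}\to\mathbb{R}$ with $\phi(1)=1$, $\phi(a^*)=\phi(a)$ and $\phi(a^*a)\ge0$ for all $a$; it is pure if it is pure as a CP map into $\mathbb{R}=B(\mathbb{R})$. The inflation of $\phi$ on $\mathcal{H}$ is the map $a\mapsto\phi(a)I_{\mathcal{H}}$. (1) Let $\mathcal{A}$ be a unital real $C^*$-algebra, let $\phi:\mathcal{A}\to\mathbb{R}$ be a pure real state, and let $(\mathcal{K},\pi,z)$ be its minimal GNS representation, i.e. $\pi:\mathcal{A}\to B(\mathcal{K})$ is a unital $*$-homomorphism, $\phi(a)=\langle\pi(a)z,z\rangle$ for all $a$, and $\pi(\mathcal{A})z$ is dense in $\mathcal{K}$. Suppose that the irreducible representation $\pi$ is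 of real type, i.e. that its commutant $\pi(\mathcal{A})'=\{T\in B(\mathcal{K}): T\pi(a)=\pi(a)T \text{ for all } a\in\mathcal{A}\}$ is isomorphic to $\mathbb{R}$. Then, for every Hilbert space $\mathcal{H}$, the inflation of $\phi$ on $\mathcal{H}$ is a $C^*$-extreme point of $\mathrm{UCP}(\mathcal{A},B(\mathcal{H}))$. (2) In particular, for every $n$, every pure real state $\phi$ of $M_n(\mathbb{R})$ and every Hilbert space $\mathcal{H}$, the inflation of $\phi$ on $\mathcal{H}$ is a $C^*$-extreme point of $\mathrm{UCP}(M_n(\mathbb{R}),B(\mathcal{H}))$. -/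

import Mathlib

open scoped InnerProductSpace

/-- Unital real C*-algebras: unital real Banach `*`-algebras with `‖a* a‖ = ‖a‖ ^ 2` in which every
`1 + a* a` is invertible. -/
class IsRealCStarAlgebra (A : Type*) [NormedRing A] [NormedAlgebra ℝ A] [StarRing A] : Prop
    extends CompleteSpace A, StarModule ℝ A, CStarRing A where
  isUnit_one_add_star_mul_self : ∀ a : A, IsUnit (1 + star a * a)

section CompletelyPositive

variable {A : Type*} [Ring A] [Algebra ℝ A] [StarRing A]
variable {B : Type*} [Ring B] [Algebra ℝ B] [StarRing B] [PartialOrder B]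

/-- Completely positive linear maps `Φ : A → B`. It is used for `B = H →L[ℝ] H` (the order is the
Loewner order of positive, in particular symmetric, operators) and for `B = ℝ`, that is, for the
operators on a one-dimensional space.

Both clauses together say that the matrices `(Φ (aᵢ* aⱼ))` over `B` are positive (symmetric, with a
nonnegative quadratic form), i.e. that all `id ⊗ Φ : M_k(A) → M_k(B)` are positive. If
`B = H →L[ℝ] H` with `dim H ≥ 2`, the first clause follows from the second one. For `B = ℝ` it has
to be demanded, since there the second clause does not see the part of `Φ` that vanishes on
self-adjoint elements. -/
structure IsCPMap (Φ : A →ₗ[ℝ] B) : Prop where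
  map_star : ∀ a : A, Φ (star a) = star (Φ a)
  sum_nonneg : ∀ (n : ℕ) (a : Fin n → A) (b : Fin n → B),
    0 ≤ ∑ i, ∑ j, star (b i) * Φ (star (a i) * a j) * b j

/-- Unital completely positive maps. -/
structure IsUCPMap (Φ : A →ₗ[ℝ] B) : Prop extends IsCPMap Φ where
  map_one : Φ 1 = 1

/-- A completely positive map is pure if the only completely positive maps dominated by it
(`Ψ ≤ Φ` when `Φ - Ψ` is completely positive) are its multiples `t Φ`, `t ∈ [0, 1]`. -/
structure IsPureMap (Φ : A →ₗ[ℝ] B) : Prop extends IsCPMap Φ where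
  eq_smul_of_dominated : ∀ Ψ : A →ₗ[ℝ] B, IsCPMap Ψ → IsCPMap (Φ - Ψ) →
    ∃ t ∈ Set.Icc (0 : ℝ) 1, Ψ = t • Φ

end CompletelyPositive

section States

variable {A : Type*} [Ring A] [Algebra ℝ A] [StarRing A]

/-- Real states: unital self-adjoint positive real-linear functionals. -/
structure IsRealState (φ : A →ₗ[ℝ] ℝ) : Prop where
  map_one : φ 1 = 1
  map_star : ∀ a : A, φ (star a) = φ a
  nonneg : ∀ a : A, 0 ≤ φ (star a * a)

variable {H : Type*} [NormedAddCommGroup H] [InnerProductSpace ℝ H]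

/-- The inflation `a ↦ φ(a) I` of a functional `φ` on the Hilbert space `H`. -/
noncomputable def inflation (H : Type*) [NormedAddCommGroup H] [InnerProductSpace ℝ H]
    (φ : A →ₗ[ℝ] ℝ) : A →ₗ[ℝ] (H →L[ℝ] H) :=
  φ.smulRight (1 : H →L[ℝ] H)

/-- `Φ` is a C*-extreme point of the set of all unital completely positive maps `A → B(H)`:
it is one of them, and in each representation of `Φ` as a proper C*-convex combination of such maps
all of these maps are unitarily equivalent to `Φ`. -/
structure IsCStarExtremePoint [CompleteSpace H] (Φ : A →ₗ[ℝ] (H →L[ℝ] H)) : Prop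
    extends IsUCPMap Φ where
  exists_unitary : ∀ (n : ℕ) (Ψ : Fin n → A →ₗ[ℝ] (H →L[ℝ] H)) (T : Fin n → (H →L[ℝ] H)),
    (∀ j, IsUCPMap (Ψ j)) → (∀ j, IsUnit (T j)) → ∑ j, star (T j) * T j = 1 →
    (∀ a, Φ a = ∑ j, star (T j) * Ψ j a * T j) →
    ∀ j, ∃ U ∈ unitary (H →L[ℝ] H), ∀ a, Ψ j a = star U * Φ a * U

end States

section Representations

variable {A : Type*} [Ring A] [Algebra ℝ A] [StarRing A]
variable {K : Type*} [NormedAddCommGroup K] [InnerProductSpace ℝ K] [CompleteSpace K]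

/-- `(K, π, z)` is a minimal GNS representation of `φ`: `π` is a representation of `A` on `K`
(a unital `*`-homomorphism), `φ(a) = ⟨π(a) z, z⟩`, and `π(A) z` spans a dense subspace of `K`. -/
structure IsMinimalGNS (φ : A →ₗ[ℝ] ℝ) (π : A →⋆ₐ[ℝ] (K →L[ℝ] K)) (z : K) : Prop where
  apply_eq_inner : ∀ a : A, φ a = ⟪π a z, z⟫_ℝ
  cyclic : (Submodule.span ℝ (Set.range fun a : A => π a z)).topologicalClosure = ⊤

/-- A representation on a nonzero Hilbert space is irreducible if it has no closed invariant
subspaces except the trivial ones. -/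
def IsIrreducibleRep (π : A →⋆ₐ[ℝ] (K →L[ℝ] K)) : Prop :=
  Nontrivial K ∧ ∀ M : Submodule ℝ K, IsClosed (M : Set K) →
    (∀ a : A, ∀ x ∈ M, π a x ∈ M) → M = ⊥ ∨ M = ⊤

/-- The commutant `π(A)'`. -/
noncomputable def repCommutant (π : A →⋆ₐ[ℝ] (K →L[ℝ] K)) : StarSubalgebra ℝ (K →L[ℝ] K) :=
  StarSubalgebra.centralizer ℝ (Set.range π)

theorem mem_repCommutant_iff (π : A →⋆ₐ[ℝ] (K →L[ℝ] K)) (T : K →L[ℝ] K) :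
    T ∈ repCommutant π ↔ ∀ a : A, T * π a = π a * T := by
  rw [repCommutant, StarSubalgebra.mem_centralizer_iff]
  constructor
  · intro h a
    exact (h _ ⟨a, rfl⟩).1.symm
  · rintro h _ ⟨a, rfl⟩
    refine ⟨(h a).symm, ?_⟩
    rw [← map_star]
    exact (h (star a)).symm

/-- An irreducible representation is of real type if its commutant is isomorphic to `ℝ`. -/
structure IsOfRealType (π : A →⋆ₐ[ℝ] (K →L[ℝ] K)) : Prop where
  irreducible : IsIrreducibleRep π
  commutant : Nonempty (repCommutant π ≃⋆ₐ[ℝ] ℝ)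

end Representations

/-! The proof is a Radon–Nikodym argument in the GNS space. If `φ(·)I = ∑ Tⱼ* Ψⱼ(·) Tⱼ`, every
summand is dominated by `φ(·)I`. By Cauchy–Schwarz the form `(a, b) ↦ ⟨Ψⱼ(b* a) Tⱼ h, Tⱼ k⟩` is then
bounded in the GNS norm, so an operator `D` on `K` implements it. It depends on `b* a` only, hence
`D` commutes with `π(A)` and is a scalar. Thus `⟨Ψⱼ(a) Tⱼ h, Tⱼ k⟩ = φ(a) ⟨Tⱼ h, Tⱼ k⟩`
(`IsMinimalGNS.inner_eq_of_dominated`), and invertibility of `Tⱼ` gives `Ψⱼ = φ(·)I`. For matrices,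
purity makes `φ` a vector functional, whose GNS representation is the standard one, with scalar
commutant. -/

theorem sum_rotate {ι κ μ M : Type*} [AddCommMonoid M] (s : Finset ι) (t : Finset κ)
    (u : Finset μ) (f : ι → κ → μ → M) :
    ∑ i ∈ s, ∑ j ∈ t, ∑ k ∈ u, f i j k = ∑ k ∈ u, ∑ i ∈ s, ∑ j ∈ t, f i j k :=
  (Finset.sum_congr rfl fun _ _ => Finset.sum_comm).trans Finset.sum_comm

/-- A bilinear form which is bounded with respect to a dense linear map `e` into a Hilbert space is
implemented by a bounded operator. -/
theorem exists_clm_inner_eq_of_bound {A K : Type*} [AddCommGroup A] [Module ℝ A]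
    [NormedAddCommGroup K] [InnerProductSpace ℝ K] [CompleteSpace K] {e : A →ₗ[ℝ] K} (he : DenseRange e)
    (B : A →ₗ[ℝ] A →ₗ[ℝ] ℝ) {C : ℝ} (hC : 0 ≤ C) (hB : ∀ a b, |B a b| ≤ C * ‖e a‖ * ‖e b‖) :
    ∃ D : K →L[ℝ] K, ∀ a b, ⟪D (e a), e b⟫_ℝ = B a b := by
  have hex : ∀ a, ∃ d : K, (∀ b, ⟪d, e b⟫_ℝ = B a b) ∧ ‖d‖ ≤ C * ‖e a‖ := by
    intro a
    -- Riesz vector of the continuous extension of `B a`; its norm bound later lets `a ↦ d a` extend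
    -- to `K`.
    refine ⟨(InnerProductSpace.toDual ℝ K).symm ((B a).extendOfNorm e), fun b => ?_, ?_⟩
    · rw [InnerProductSpace.toDual_symm_apply]
      exact LinearMap.extendOfNorm_eq he ⟨C * ‖e a‖, hB a⟩ b
    · rw [LinearIsometryEquiv.norm_map]
      exact LinearMap.opNorm_extendOfNorm_le he (by positivity) (hB a)
  choose d hd hdn using hex
  have huniq : ∀ u v : K, (∀ b, ⟪u, e b⟫_ℝ = ⟪v, e b⟫_ℝ) → u = v := by
    intro u v huv
    refine ext_inner_right ℝ fun w => ?_
    exact he.induction (P := fun w => ⟪u, w⟫_ℝ = ⟪v, w⟫_ℝ) (by rintro _ ⟨b, rfl⟩; exact huv b)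
      (isClosed_eq (by fun_prop) (by fun_prop)) w
  let f : A →ₗ[ℝ] K :=
    { toFun := d
      map_add' := fun a a' => huniq _ _ fun b => by simp [inner_add_left, hd]
      map_smul' := fun c a => huniq _ _ fun b => by simp [real_inner_smul_left, hd] }
  refine ⟨f.extendOfNorm e, fun a b => ?_⟩
  rw [LinearMap.extendOfNorm_eq he ⟨C, hdn⟩ a]
  exact hd a b

/-! ### Completely positive maps and domination by a state -/

section Operators

variable {A : Type*} [Ring A] [Algebra ℝ A] [StarRing A]
variable {K : Type*} [NormedAddCommGroup K] [InnerProductSpace ℝ K] [CompleteSpace K]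
variable {H : Type*} [NormedAddCommGroup H] [InnerProductSpace ℝ H] [CompleteSpace H]

theorem IsCPMap.sum_inner_nonneg {Ψ : A →ₗ[ℝ] (H →L[ℝ] H)} (hΨ : IsCPMap Ψ) {n : ℕ}
    (a : Fin n → A) (x : Fin n → H) :
    0 ≤ ∑ i, ∑ j, ⟪Ψ (star (a i) * a j) (x j), x i⟫_ℝ := by
  rcases subsingleton_or_nontrivial H with hH | hH
  · simp [Subsingleton.elim _ (0 : H)]
  -- The rank-one coefficients `⟨e, ·⟩ xᵢ` send the unit vector `e` to `xᵢ`, so testing at `e` gives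
  -- the scalar inequality.
  obtain ⟨e, he⟩ := exists_norm_eq H zero_le_one
  have hpos := (ContinuousLinearMap.nonneg_iff_isPositive _).1
    (hΨ.sum_nonneg n a fun i => (innerSL ℝ e).smulRight (x i))
  simpa [sum_apply, sum_inner, ContinuousLinearMap.star_eq_adjoint,
    ContinuousLinearMap.adjoint_inner_left, real_inner_self_eq_norm_sq, he]
    using hpos.inner_nonneg_left e

theorem IsCPMap.inner_nonneg {Ψ : A →ₗ[ℝ] (H →L[ℝ] H)} (hΨ : IsCPMap Ψ) (a : A) (x : H) :
    0 ≤ ⟪Ψ (star a * a) x, x⟫_ℝ := by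
  simpa using hΨ.sum_inner_nonneg (n := 1) (fun _ => a) fun _ => x

theorem IsCPMap.inner_comm {Ψ : A →ₗ[ℝ] (H →L[ℝ] H)} (hΨ : IsCPMap Ψ) (a b : A) (x y : H) :
    ⟪Ψ (star a * b) y, x⟫_ℝ = ⟪Ψ (star b * a) x, y⟫_ℝ := by
  rw [← star_star a, ← star_mul, hΨ.map_star, star_star, ContinuousLinearMap.star_eq_adjoint,
    ContinuousLinearMap.adjoint_inner_left, real_inner_comm]

/-- The Cauchy-Schwarz inequality for a completely positive map. -/
theorem IsCPMap.sq_inner_le {Ψ : A →ₗ[ℝ] (H →L[ℝ] H)} (hΨ : IsCPMap Ψ) (a b : A) (x y : H) :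
    ⟪Ψ (star b * a) x, y⟫_ℝ ^ 2 ≤ ⟪Ψ (star a * a) x, x⟫_ℝ * ⟪Ψ (star b * b) y, y⟫_ℝ := by
  have h := discrim_le_zero (a := ⟪Ψ (star a * a) x, x⟫_ℝ) (b := 2 * ⟪Ψ (star b * a) x, y⟫_ℝ)
    (c := ⟪Ψ (star b * b) y, y⟫_ℝ) fun t => by
      have h2 := hΨ.sum_inner_nonneg ![a, b] ![t • x, y]
      simp only [Fin.sum_univ_two, Matrix.cons_val_zero, Matrix.cons_val_one, map_smul,
        real_inner_smul_left, real_inner_smul_right, hΨ.inner_comm a b] at h2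
      linarith
  rw [discrim] at h
  linarith

/-- The inflation of a completely positive functional is completely positive. -/
theorem IsCPMap.inflation {φ : A →ₗ[ℝ] ℝ} (hφ : IsCPMap φ) : IsCPMap (inflation H φ) where
  map_star a := by
    simp [_root_.inflation, hφ.map_star]
  sum_nonneg n a b := by
    have hsymm : ∀ i j, φ (star (a i) * a j) = φ (star (a j) * a i) := fun i j => by
      simpa using (hφ.map_star (star (a j) * a i))
    have hM : (Matrix.of fun i j => φ (star (a i) * a j)).PosSemidef := by
      refine Matrix.PosSemidef.of_dotProduct_mulVec_nonneg (Matrix.IsHermitian.ext fun i j => ?_)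
        fun x => ?_
      · simpa using hsymm j i
      · simpa [dotProduct, Matrix.mulVec, Finset.mul_sum, mul_assoc] using hφ.sum_nonneg n a x
    obtain ⟨m, v, hv⟩ := Matrix.posSemidef_iff_eq_sum_vecMulVec.1 hM
    have hentry : ∀ i j, φ (star (a i) * a j) = ∑ k, v k i * v k j := fun i j => by
      simpa [Matrix.sum_apply, Matrix.vecMulVec_apply] using congrFun₂ hv i j
    -- Splitting the Gram matrix of `φ` into rank-one terms turns the double sum into a sum of `S*
    -- S`.
    have hsum : ∑ i, ∑ j, star (b i) * _root_.inflation H φ (star (a i) * a j) * b j =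
        ∑ k, star (∑ i, v k i • b i) * ∑ j, v k j • b j := by
      simp only [star_sum, Finset.sum_mul_sum]
      rw [← sum_rotate]
      refine Finset.sum_congr rfl fun i _ => Finset.sum_congr rfl fun j _ => ?_
      simp only [_root_.inflation, LinearMap.smulRight_apply, hentry, star_smul, star_trivial,
        mul_smul_comm, smul_mul_assoc, mul_one]
      simp only [Finset.sum_smul, mul_smul]
      exact Finset.sum_congr rfl fun k _ => smul_comm _ _ _
    rw [hsum, ContinuousLinearMap.nonneg_iff_isPositive]
    refine ContinuousLinearMap.isPositive_sum _ fun k _ => ?_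
    exact ContinuousLinearMap.isPositive_adjoint_comp_self _

/-- An isomorphism `f` onto `ℝ` takes the same value at `D` and at `f(D) • 1`, and it is injective.
-/
theorem IsOfRealType.exists_eq_smul_one {π : A →⋆ₐ[ℝ] (K →L[ℝ] K)} (hπ : IsOfRealType π)
    (D : K →L[ℝ] K) (hD : ∀ a, D * π a = π a * D) : ∃ c : ℝ, D = c • 1 := by
  obtain ⟨f⟩ := hπ.commutant
  let d : repCommutant π := ⟨D, (mem_repCommutant_iff π D).2 hD⟩
  refine ⟨f d, ?_⟩
  have h : d = f d • (1 : repCommutant π) := EquivLike.injective f <| by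
    have h1 : f 1 = 1 := map_one f.toRingEquiv
    have h2 : f (f d • 1) = f d • f 1 := f.map_smul' _ _
    rw [h2, h1, smul_eq_mul, mul_one]
  exact congrArg Subtype.val h

variable [StarModule ℝ A]

/-- If the GNS representation of `φ` has only scalar operators in its commutant, then a completely
positive map whose compression by `T` is dominated by `φ` is compressed to a multiple of `φ`. -/
theorem IsMinimalGNS.inner_eq_of_dominated {φ : A →ₗ[ℝ] ℝ} {π : A →⋆ₐ[ℝ] (K →L[ℝ] K)} {z : K}
    (hπ : IsMinimalGNS φ π z) (hφ : φ 1 = 1)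
    (hcomm : ∀ D : K →L[ℝ] K, (∀ a, D * π a = π a * D) → ∃ c : ℝ, D = c • 1)
    {Ψ : A →ₗ[ℝ] (H →L[ℝ] H)} (hΨ : IsCPMap Ψ) {T : H →L[ℝ] H}
    (hdom : ∀ a h, ⟪Ψ (star a * a) (T h), T h⟫_ℝ ≤ φ (star a * a) * ‖h‖ ^ 2) (a : A) (h k : H) :
    ⟪Ψ a (T h), T k⟫_ℝ = φ a * ⟪Ψ 1 (T h), T k⟫_ℝ := by
  let e : A →ₗ[ℝ] K :=
    { toFun := fun a => π a z
      map_add' := fun a b => by simp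
      map_smul' := fun c a => by simp }
  have hrange : (Set.range fun a : A => π a z) = (LinearMap.range e : Set K) := rfl
  have he : DenseRange e := by
    have := hπ.cyclic
    rw [hrange, Submodule.span_eq] at this
    exact (Submodule.dense_iff_topologicalClosure_eq_top (s := LinearMap.range e)).2 this
  have hnorm : ∀ a, φ (star a * a) = ‖e a‖ ^ 2 := fun a => by
    rw [hπ.apply_eq_inner, map_mul, map_star, mul_apply_eq_comp,
      ContinuousLinearMap.star_eq_adjoint, ContinuousLinearMap.adjoint_inner_left,
      real_inner_self_eq_norm_sq]
    rfl
  let B : A →ₗ[ℝ] A →ₗ[ℝ] ℝ := LinearMap.mk₂ ℝ (fun a b => ⟪Ψ (star b * a) (T h), T k⟫_ℝ)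
    (fun a a' b => by simp [mul_add, inner_add_left])
    (fun c a b => by simp [real_inner_smul_left])
    (fun a b b' => by simp [add_mul, inner_add_left])
    (fun c a b => by simp [real_inner_smul_left])
  have hB : ∀ a b, |B a b| ≤ ‖h‖ * ‖k‖ * ‖e a‖ * ‖e b‖ := by
    intro a b
    refine abs_le_of_sq_le_sq ?_ (by positivity)
    calc B a b ^ 2 ≤ _ := hΨ.sq_inner_le a b (T h) (T k)
      _ ≤ (φ (star a * a) * ‖h‖ ^ 2) * (φ (star b * b) * ‖k‖ ^ 2) :=
        mul_le_mul (hdom a h) (hdom b k) (hΨ.inner_nonneg b _) (by rw [hnorm]; positivity)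
      _ = _ := by rw [hnorm, hnorm]; ring
  obtain ⟨D, hD⟩ := exists_clm_inner_eq_of_bound he B (by positivity) hB
  -- Since `b* (c a) = (c* b)* a`, the form lets `c` pass from one argument to the other as `c*`.
  have hDcomm : ∀ c, D * π c = π c * D := by
    intro c
    ext w
    refine he.induction (P := fun w => (D * π c) w = (π c * D) w) ?_
      (isClosed_eq (by fun_prop) (by fun_prop)) w
    rintro _ ⟨a, rfl⟩
    refine ext_inner_right ℝ fun u => ?_
    refine he.induction (P := fun u => ⟪(D * π c) (e a), u⟫_ℝ = ⟪(π c * D) (e a), u⟫_ℝ) ?_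
      (isClosed_eq (by fun_prop) (by fun_prop)) u
    rintro _ ⟨b, rfl⟩
    have h1 : π c (e a) = e (c * a) := by simp [e]
    have h2 : ContinuousLinearMap.adjoint (π c) (e b) = e (star c * b) := by
      simp [e, map_star, ContinuousLinearMap.star_eq_adjoint]
    rw [mul_apply_eq_comp, mul_apply_eq_comp, h1, hD,
      ← ContinuousLinearMap.adjoint_inner_right, h2, hD]
    simp [B, mul_assoc]
  obtain ⟨c, hc⟩ := hcomm D hDcomm
  have key : ∀ a, ⟪Ψ a (T h), T k⟫_ℝ = c * φ a := by
    intro a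
    have := hD a 1
    simp only [hc, B, LinearMap.mk₂_apply, star_one, one_mul] at this
    rw [← this, hπ.apply_eq_inner]
    simp [e, real_inner_smul_left]
  rw [key a, key 1, hφ]
  ring

/-- The inflation of a completely positive state whose GNS representation has only scalar operators
in its commutant is C*-extreme. -/
theorem IsMinimalGNS.isCStarExtremePoint_inflation {φ : A →ₗ[ℝ] ℝ} {π : A →⋆ₐ[ℝ] (K →L[ℝ] K)}
    {z : K} (hπ : IsMinimalGNS φ π z) (hφ : φ 1 = 1) (hcp : IsCPMap φ)
    (hcomm : ∀ D : K →L[ℝ] K, (∀ a, D * π a = π a * D) → ∃ c : ℝ, D = c • 1) :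
    IsCStarExtremePoint (inflation H φ) where
  toIsCPMap := hcp.inflation
  map_one := by simp [inflation, hφ]
  exists_unitary n Ψ T hΨ hT _ hsum j := by
    -- The identity serves as the unitary, because `Ψ j` turns out to equal the inflation itself.
    refine ⟨1, one_mem _, fun a => ?_⟩
    have hdom : ∀ a h, ⟪Ψ j (star a * a) (T j h), T j h⟫_ℝ ≤ φ (star a * a) * ‖h‖ ^ 2 := by
      intro a h
      have h1 : φ (star a * a) * ‖h‖ ^ 2 = ∑ i, ⟪Ψ i (star a * a) (T i h), T i h⟫_ℝ := by
        have := congrArg (fun S : H →L[ℝ] H => ⟪S h, h⟫_ℝ) (hsum (star a * a))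
        simpa [inflation, sum_apply, sum_inner, real_inner_smul_left,
          ContinuousLinearMap.star_eq_adjoint, ContinuousLinearMap.adjoint_inner_left,
          real_inner_self_eq_norm_sq] using this
      rw [h1]
      exact Finset.single_le_sum
        (f := fun i => ⟪Ψ i (star a * a) (T i h), T i h⟫_ℝ)
        (fun i _ => (hΨ i).toIsCPMap.inner_nonneg a (T i h)) (Finset.mem_univ j)
    obtain ⟨u, hu⟩ := hT j
    have hsurj : ∀ x, T j ((↑u⁻¹ : H →L[ℝ] H) x) = x := fun x => by
      rw [← hu, ← mul_apply_eq_comp, u.mul_inv, one_apply_eq_self]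
    ext x
    refine ext_inner_right ℝ fun y => ?_
    have := hπ.inner_eq_of_dominated hφ hcomm (hΨ j).toIsCPMap hdom a
      ((↑u⁻¹ : H →L[ℝ] H) x) ((↑u⁻¹ : H →L[ℝ] H) y)
    rw [hsurj, hsurj, (hΨ j).map_one] at this
    simpa [inflation, real_inner_smul_left] using this

end Operators

/-! ### Pure states of real matrix algebras -/

section Matrices

variable {n : ℕ}

/-- The functional `a ↦ ⟨a v, v⟩` on matrices. -/
noncomputable def vectorFunctional (v : EuclideanSpace ℝ (Fin n)) :
    Matrix (Fin n) (Fin n) ℝ →ₗ[ℝ] ℝ where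
  toFun a := ⟪Matrix.toEuclideanCLM (𝕜 := ℝ) a v, v⟫_ℝ
  map_add' a b := by simp [inner_add_left]
  map_smul' c a := by simp [real_inner_smul_left]

theorem vectorFunctional_apply (v : EuclideanSpace ℝ (Fin n)) (a : Matrix (Fin n) (Fin n) ℝ) :
    vectorFunctional v a = ⟪Matrix.toEuclideanCLM (𝕜 := ℝ) a v, v⟫_ℝ := rfl

theorem vectorFunctional_star_mul (v : EuclideanSpace ℝ (Fin n))
    (a b : Matrix (Fin n) (Fin n) ℝ) :
    vectorFunctional v (star a * b) =
      ⟪Matrix.toEuclideanCLM (𝕜 := ℝ) b v, Matrix.toEuclideanCLM (𝕜 := ℝ) a v⟫_ℝ := by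
  rw [vectorFunctional_apply, map_mul, map_star, mul_apply_eq_comp,
    ContinuousLinearMap.star_eq_adjoint, ContinuousLinearMap.adjoint_inner_left]

theorem isCPMap_vectorFunctional (v : EuclideanSpace ℝ (Fin n)) :
    IsCPMap (vectorFunctional v) where
  map_star a := by
    have h := vectorFunctional_star_mul v a 1
    rw [mul_one] at h
    rw [h, vectorFunctional_apply, real_inner_comm]
    simp
  sum_nonneg m a b := by
    have h : ∑ i, ∑ j, star (b i) * vectorFunctional v (star (a i) * a j) * b j =
        ⟪∑ j, b j • Matrix.toEuclideanCLM (𝕜 := ℝ) (a j) v,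
          ∑ i, b i • Matrix.toEuclideanCLM (𝕜 := ℝ) (a i) v⟫_ℝ := by
      simp only [vectorFunctional_star_mul, sum_inner, inner_sum, real_inner_smul_left,
        real_inner_smul_right, star_trivial]
      refine Finset.sum_congr rfl fun i _ => Finset.sum_congr rfl fun j _ => ?_
      rw [real_inner_comm]
      ring
    rw [h]
    exact real_inner_self_nonneg

/-- A real state on matrices is a sum of vector functionals. -/
theorem IsRealState.exists_eq_sum_vectorFunctional {φ : Matrix (Fin n) (Fin n) ℝ →ₗ[ℝ] ℝ}
    (hφ : IsRealState φ) :
    ∃ (m : ℕ) (v : Fin m → EuclideanSpace ℝ (Fin n)), φ = ∑ k, vectorFunctional (v k) := by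
  have hexp : ∀ a, φ a = ∑ i, ∑ j, a i j * φ (Matrix.single i j 1) := by
    intro a
    conv_lhs => rw [Matrix.matrix_eq_sum_single a]
    simp only [map_sum]
    refine Finset.sum_congr rfl fun i _ => Finset.sum_congr rfl fun j _ => ?_
    rw [← smul_eq_mul, ← map_smul, Matrix.smul_single, smul_eq_mul, mul_one]
  have hM : (Matrix.of fun i j => φ (Matrix.single i j (1 : ℝ))).PosSemidef := by
    refine Matrix.PosSemidef.of_dotProduct_mulVec_nonneg (Matrix.IsHermitian.ext fun i j => ?_)
      fun x => ?_
    · simpa [Matrix.star_eq_conjTranspose] using hφ.map_star (Matrix.single i j (1 : ℝ))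
    · rcases n with _ | n
      · simp
      -- For `a = e₀ xᵀ` one has `a* a = x xᵀ`; the index `0` is why `n = 0` was split off.
      have h := hφ.nonneg (Matrix.vecMulVec (Pi.single 0 1) x)
      rw [Matrix.star_eq_conjTranspose, Matrix.conjTranspose_vecMulVec,
        Matrix.vecMulVec_mul_vecMulVec, hexp] at h
      simpa [dotProduct, Matrix.mulVec, Finset.mul_sum, Matrix.vecMulVec_apply, mul_assoc,
        mul_comm, mul_left_comm, Pi.single_apply] using h
  obtain ⟨m, v, hv⟩ := Matrix.posSemidef_iff_eq_sum_vecMulVec.1 hM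
  refine ⟨m, fun k => WithLp.toLp 2 (v k), LinearMap.ext fun a => ?_⟩
  have hentry : ∀ i j, φ (Matrix.single i j 1) = ∑ k, v k i * v k j := fun i j => by
    simpa [Matrix.sum_apply, Matrix.vecMulVec_apply] using congrFun₂ hv i j
  rw [hexp, LinearMap.sum_apply]
  simp only [hentry, vectorFunctional_apply, real_inner_comm, Matrix.inner_toEuclideanCLM,
    dotProduct, Matrix.mulVec, Finset.mul_sum]
  rw [sum_rotate]
  refine Finset.sum_congr rfl fun k _ => Finset.sum_congr rfl fun i _ =>
    Finset.sum_congr rfl fun j _ => ?_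
  ring

/-- A pure real state on matrices is a vector state. -/
theorem IsRealState.exists_eq_vectorFunctional {φ : Matrix (Fin n) (Fin n) ℝ →ₗ[ℝ] ℝ}
    (hφ : IsRealState φ) (hpure : IsPureMap φ) :
    ∃ z : EuclideanSpace ℝ (Fin n), φ = vectorFunctional z := by
  obtain ⟨m, v, hv⟩ := hφ.exists_eq_sum_vectorFunctional
  have hcp : ∀ s : Finset (Fin m), IsCPMap (∑ k ∈ s, vectorFunctional (v k)) := fun s =>
    { map_star := fun a => by
        simp only [LinearMap.sum_apply, star_sum, (isCPMap_vectorFunctional _).map_star]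
      sum_nonneg := fun p a b => by
        have h : ∑ i, ∑ j, star (b i) * (∑ k ∈ s, vectorFunctional (v k)) (star (a i) * a j) * b j
            = ∑ k ∈ s, ∑ i, ∑ j, star (b i) * vectorFunctional (v k) (star (a i) * a j) * b j := by
          simp only [LinearMap.sum_apply, Finset.mul_sum, Finset.sum_mul]
          exact sum_rotate _ _ _ _
        rw [h]
        exact Finset.sum_nonneg fun k _ => (isCPMap_vectorFunctional (v k)).sum_nonneg p a b }
  obtain ⟨k, hk⟩ : ∃ k, vectorFunctional (v k) 1 ≠ 0 := by
    by_contra! h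
    have h1 := hφ.map_one
    rw [hv, LinearMap.sum_apply, Finset.sum_eq_zero fun k _ => h k] at h1
    exact zero_ne_one h1
  obtain ⟨t, ht, htv⟩ := hpure.eq_smul_of_dominated (vectorFunctional (v k))
    (isCPMap_vectorFunctional _) (by
      have := hcp (Finset.univ.erase k)
      rwa [Finset.sum_erase_eq_sub (Finset.mem_univ k), ← hv] at this)
  have ht0 : 0 < t := lt_of_le_of_ne ht.1 (by rintro rfl; simp [htv] at hk)
  -- The functional is quadratic in the vector, so this scaling absorbs the factor `t⁻¹`.
  refine ⟨(√t)⁻¹ • v k, LinearMap.ext fun a => ?_⟩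
  have h1 := LinearMap.congr_fun htv a
  have h2 : vectorFunctional ((√t)⁻¹ • v k) a = t⁻¹ * vectorFunctional (v k) a := by
    rw [vectorFunctional_apply, map_smul, real_inner_smul_left, real_inner_smul_right,
      ← mul_assoc, ← mul_inv, Real.mul_self_sqrt ht0.le, vectorFunctional_apply]
  rw [h2, h1, LinearMap.smul_apply, smul_eq_mul, inv_mul_cancel_left₀ ht0.ne']

theorem exists_eq_smul_one_of_commute_all {K : Type*} [NormedAddCommGroup K]
    [InnerProductSpace ℝ K] {z : K} (hz : z ≠ 0) (D : K →L[ℝ] K)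
    (hD : ∀ S : K →L[ℝ] K, D * S = S * D) : ∃ c : ℝ, D = c • 1 := by
  refine ⟨(‖z‖ ^ 2)⁻¹ * ⟪z, D z⟫_ℝ, ContinuousLinearMap.ext fun w => ?_⟩
  -- Commuting with `S = ⟨z, ·⟩ w` and evaluating at `z` gives `‖z‖² D w = ⟨z, D z⟩ w`.
  have h := congrArg (fun S : K →L[ℝ] K => S z) (hD ((innerSL ℝ z).smulRight w))
  simp only [mul_apply_eq_comp, ContinuousLinearMap.smulRight_apply, innerSL_apply_apply,
    map_smul, real_inner_self_eq_norm_sq] at h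
  rw [smul_apply, one_apply_eq_self, mul_smul, ← h,
    inv_smul_smul₀ (by simpa using hz)]

theorem isMinimalGNS_vectorFunctional {z : EuclideanSpace ℝ (Fin n)} (hz : z ≠ 0) :
    IsMinimalGNS (vectorFunctional z)
      (Matrix.toEuclideanCLM (n := Fin n) (𝕜 := ℝ) : _ →⋆ₐ[ℝ] _) z where
  apply_eq_inner _ := rfl
  cyclic := by
    refine top_unique fun w _ => Submodule.le_topologicalClosure _ (Submodule.subset_span ?_)
    -- A rank-one matrix carries `z` to any prescribed `w`, so the orbit of `z` is already the whole
    -- space.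
    obtain ⟨a, ha : Matrix.toEuclideanCLM (n := Fin n) (𝕜 := ℝ) a = _⟩ := (Matrix.toEuclideanCLM (n := Fin n) (𝕜 := ℝ)).surjective
      ((innerSL ℝ z).smulRight ((‖z‖ ^ 2)⁻¹ • w))
    refine ⟨a, ?_⟩
    have : Matrix.toEuclideanCLM (n := Fin n) (𝕜 := ℝ) a z = w := by
      rw [ha, ContinuousLinearMap.smulRight_apply, innerSL_apply_apply, real_inner_self_eq_norm_sq,
        smul_inv_smul₀ (by simpa using hz)]
    exact this

end Matrices

theorem mainTheorem9 :
    (∀ (A : Type*) [NormedRing A] [NormedAlgebra ℝ A] [StarRing A] [IsRealCStarAlgebra A]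
        (K : Type*) [NormedAddCommGroup K] [InnerProductSpace ℝ K] [CompleteSpace K]
        (H : Type*) [NormedAddCommGroup H] [InnerProductSpace ℝ H] [CompleteSpace H]
        (φ : A →ₗ[ℝ] ℝ) (π : A →⋆ₐ[ℝ] (K →L[ℝ] K)) (z : K),
        IsRealState φ → IsPureMap φ → IsMinimalGNS φ π z → IsOfRealType π →
        IsCStarExtremePoint (inflation H φ)) ∧
    (∀ (n : ℕ) (H : Type*) [NormedAddCommGroup H] [InnerProductSpace ℝ H] [CompleteSpace H]
        (φ : Matrix (Fin n) (Fin n) ℝ →ₗ[ℝ] ℝ),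
        IsRealState φ → IsPureMap φ → IsCStarExtremePoint (inflation H φ)) := by
  refine ⟨?_, ?_⟩
  · intro A _ _ _ _ K _ _ _ H _ _ _ φ π z hφ hpure hπ hreal
    exact hπ.isCStarExtremePoint_inflation hφ.map_one hpure.toIsCPMap hreal.exists_eq_smul_one
  · intro n H _ _ _ φ hφ hpure
    obtain ⟨z, rfl⟩ := hφ.exists_eq_vectorFunctional hpure
    have hz : z ≠ 0 := by
      rintro rfl
      have := hφ.map_one
      simp [vectorFunctional_apply] at this
    refine (isMinimalGNS_vectorFunctional hz).isCStarExtremePoint_inflation hφ.map_one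
      hpure.toIsCPMap fun D hD => exists_eq_smul_one_of_commute_all hz D fun S => ?_
    obtain ⟨a, rfl⟩ := (Matrix.toEuclideanCLM (n := Fin n) (𝕜 := ℝ)).surjective S
    exact hD a
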